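/- Let $K$ be a field, let $d,\mu>0$, and let $\mathcal A\subset\mathbb N^d$ be a configuration. Here a finite set $\mathcal C\subset\mathbb Z^n$ is called a configuration if there is $0\neq\lambda\in\mathbb Q^n$ with $\lambda\cdot \mathbf c=1$ for all $\mathbf c\in\mathcal C$. Let $\mathcal V$ be a $\nu\times\mu$ integer matrix and let $\mathbf w_1,\dots,\mathbf w_d\in\mathbb Z^\nu$ be linearly independent. For each $i$ let $\mathcal B_i$ be a (possibly empty) finite subset of the fiber $\{\mathbf b\in\mathbb Z^\mu\mid \mathcal V\cdot\mathbf b=\mathbf w_i\}$, and put $\mathcal B=\mathcal B_1\cup\dots\cup\mathcal B_d$. Let $\tilde{\mathcal A}$ be the set of all families $a=(a_{i,\mathbf b})_{1\le i\le d,\ \mathbf b\in\mathcal B_i}$ of non-negative integers such that $\bigl(\sum_{\mathbf b\in\mathcal B_1}a_{1,\mathbf b},\dots,\sum_{\mathbf b\in\mathcal B_d}a_{d,\mathbf b}\bigr)\in\mathcal A$, and define the generalized nested configuration $$\mathcal A[\mathcal B_1,\dots,\mathcal B_d]=\Bigl\{\sum_{i=1}^d\sum_{\mathbf b\in\mathcal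 B_i}a_{i,\mathbf b}\,\mathbf b\ \Bigm|\ a\in\tilde{\mathcal A}\Bigr\}\subset\mathbb Z^\mu .$$ For a finite family $\mathcal C=(\mathbf c_j)_{j\in J}$ of vectors in $\mathbb Z^n$, let $P_{\mathcal C}$ be the kernel of the $K$-algebra homomorphism $K[x_j\mid j\in J]\to K[z_1^{\pm1},\dots,z_n^{\pm1}]$, $x_j\mapsto \mathbf z^{\mathbf c_j}$ (the toric ideal); a finite set is regarded as the family of its distinct elements. An ideal $I$ of a polynomial ring admits an initial ideal of degree at most $m$ (respectively, a square-free initial ideal) if, for some term order $\prec$, the ideal $\mathrm{in}_\prec(I)$ is generated by monomials of degree at most $m$ (respectively, by square-free monomials). Then $\mathcal B$ is a configuration of $\mathbb Z^\mu$, and the following hold. 1. For every integer $m\ge 2$: if $P_{\mathcal B}$ and $P_{\mathcal A}$ both admit initial ideals of degree at most $m$, then so does $P_{\mathcal A[\mathcal B_1,\dots,\mathcal B_d]}$. 2. If $P_{\mathcal B}$ and $P_{\mathcal A}$ both admit square-free initial ideals, then so does $P_{\mathcal A[\mathcal B_1,\dots,\mathcal B_d]}$. Both conclusions hold whether $\mathcal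 A[\mathcal B_1,\dots,\mathcal B_d]$ is regarded as a set of distinct vectors, or as the family of vectors $\sum a_{i,\mathbf b}\mathbf b$ indexed by $a\in\tilde{\mathcal A}$, possibly with repetitions. -/

import Mathlib

noncomputable section

/-- A configuration in `ℤ^κ`: a finite set of integer vectors lying on a rational affine hyperplane
`l ⬝ a = 1` with `l ≠ 0`. -/
def IsConfiguration {κ : Type} [Fintype κ] (A : Set (κ → ℤ)) : Prop :=
  A.Finite ∧ ∃ l : κ → ℚ, l ≠ 0 ∧ ∀ a ∈ A, ∑ i, l i * (a i : ℚ) = 1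

/-- The monomial homomorphism `K[x_j | j ∈ ι] → K[z^{±1}]`, `x_j ↦ z^{a_j}`, given by a family
`a` of integer vectors (the columns of a matrix). The Laurent polynomial ring in the variables
`z_k`, `k ∈ κ`, is the group algebra of `ℤ^κ`. -/
def monomialHom (K : Type*) [Field K] {ι κ : Type} (a : ι → κ → ℤ) :
    MvPolynomial ι K →ₐ[K] AddMonoidAlgebra K (κ → ℤ) :=
  MvPolynomial.aeval fun j => AddMonoidAlgebra.single (a j) 1

/-- The toric ideal of a family of integer vectors (the columns of a matrix). -/
def toricIdeal (K : Type*) [Field K] {ι κ : Type} (a : ι → κ → ℤ) : Ideal (MvPolynomial ι K) :=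
  RingHom.ker (monomialHom K a)

/-- The toric ideal of a set of integer vectors: one variable for each element of the set. -/
def toricIdealOfSet (K : Type*) [Field K] {κ : Type} (A : Set (κ → ℤ)) :
    Ideal (MvPolynomial A K) :=
  toricIdeal K (fun a : A => (a : κ → ℤ))

/-- The initial ideal of `I` with respect to a term order. -/
def initialIdeal {K : Type*} [Field K] {ι : Type} (ord : MonomialOrder.{0, 0} ι)
    (I : Ideal (MvPolynomial ι K)) : Ideal (MvPolynomial ι K) :=
  Ideal.span {g | ∃ f ∈ I, g = ord.leadingTerm f}

/-- For some term order, the initial ideal of `I` is generated by monomials of degree at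
most `m`. -/
def AdmitsInitialIdealOfDegreeLE {K : Type*} [Field K] {ι : Type} (m : ℕ)
    (I : Ideal (MvPolynomial ι K)) : Prop :=
  ∃ (ord : MonomialOrder.{0, 0} ι) (T : Set (ι →₀ ℕ)), (∀ t ∈ T, t.degree ≤ m) ∧
    initialIdeal ord I = Ideal.span ((fun t => MvPolynomial.monomial t (1 : K)) '' T)

/-- For some term order, the initial ideal of `I` is generated by square-free monomials. -/
def AdmitsSquarefreeInitialIdeal {K : Type*} [Field K] {ι : Type}
    (I : Ideal (MvPolynomial ι K)) : Prop :=
  ∃ (ord : MonomialOrder.{0, 0} ι) (T : Set (ι →₀ ℕ)), (∀ t ∈ T, ∀ i, t i ≤ 1) ∧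
    initialIdeal ord I = Ideal.span ((fun t => MvPolynomial.monomial t (1 : K)) '' T)

/-- The exponent vectors `a` of the monomials `y^a` in the variables `y_{i,b}`, `b ∈ B_i`, whose
multidegree, for the grading with `deg y_{i,b} = e_i`, lies in `A`. -/
def nestedExponents {d μ : ℕ} (A : Set (Fin d → ℤ)) (B : Fin d → Finset (Fin μ → ℤ)) :
    Set ((Σ i, B i) → ℕ) :=
  {a | (fun i => ∑ b : B i, (a ⟨i, b⟩ : ℤ)) ∈ A}

/-- The vector `∑_{i, b ∈ B_i} a_{i,b} b`. -/
def nestedVector {d μ : ℕ} (B : Fin d → Finset (Fin μ → ℤ)) (a : (Σ i, B i) → ℕ) : Fin μ → ℤ :=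
  ∑ i, ∑ b : B i, a ⟨i, b⟩ • (b : Fin μ → ℤ)

/-- The generalized nested configuration `A[B_1, …, B_d]`, as a set of vectors. -/
def nestedConfiguration {d μ : ℕ} (A : Set (Fin d → ℤ)) (B : Fin d → Finset (Fin μ → ℤ)) :
    Set (Fin μ → ℤ) :=
  nestedVector B '' nestedExponents A B

/-- The toric ideal of the matrix whose columns are the vectors `∑ a_{i,b} b`, one column for each
`a ∈ nestedExponents A B`, so that equal vectors are listed with repetition. -/
def nestedMatrixToricIdeal (K : Type*) [Field K] {d μ : ℕ} (A : Set (Fin d → ℤ))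
    (B : Fin d → Finset (Fin μ → ℤ)) : Ideal (MvPolynomial (nestedExponents A B) K) :=
  toricIdeal K (fun a : nestedExponents A B => nestedVector B a)

end

/-! A toric ideal is spanned by binomials, so its initial ideal is spanned by the monomials whose
exponent is not the smallest in its fiber (`initialIdeal_toricIdeal`). Everything becomes a question
about which exponents generate the non-minimal ones.

Let E be the set of exponents of y-monomials with degree in A. A monomial in the variables indexed
by E has two shadows: its product, a monomial in the y's, and its multiset of degrees, a monomial in
the variables of A. Compare products by the order of B, then degrees by the order of A, then use a
sorting order. A non-minimal u falls into one of three cases. If its product is non-minimal for B,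
or its degree monomial is non-minimal for A, a generator p of class P divides that shadow, and some
divisor of u of class P already has a shadow divisible by p (`IsTransferable.cover`). The smaller
shadow lifts back to the variables of E by `exists_prodExponent_eq`; for B, linear independence of
the w's keeps the multidegree unchanged. Otherwise the smaller competitor has the same two shadows,
and the sorting order yields a non-minimal product of two distinct variables
(`exists_sorting_order`), which is square-free of degree 2.

The sorting order rests on `eq_of_forall_isSorted`: a monomial with pairwise sorted factors is
determined by its two shadows, while an unsorted pair can be replaced by a smaller one. Repeated
vectors are removed at the end by `IsGeneratedBy.restrict`. -/

/-! ### Term orders and non-minimal exponents. -/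

/-- The monomial order pulled back along an injective additive map into a well-ordered monoid. -/
noncomputable def MonomialOrder.lift {ι : Type} {N : Type} [AddCommMonoid N] [LinearOrder N]
    [IsOrderedAddMonoid N] [WellFoundedLT N] (f : (ι →₀ ℕ) →+ N) (hf : Function.Injective f)
    (h0 : ∀ u, 0 ≤ f u) : MonomialOrder.{0, 0} ι :=
  letI lo : LinearOrder (ι →₀ ℕ) := LinearOrder.lift' f hf
  { syn := ι →₀ ℕ
    addCommMonoidSyn := inferInstance
    linearOrderSyn := lo
    isOrderedAddMonoid_syn :=
      @IsOrderedAddMonoid.mk (ι →₀ ℕ) _ lo.toPreorder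
        (fun a b hab c => by
          change f (a + c) ≤ f (b + c)
          rw [map_add, map_add]
          exact add_le_add_left (show f a ≤ f b from hab) (f c))
        (fun a b hab c => by
          change f (c + a) ≤ f (c + b)
          rw [map_add, map_add]
          exact add_le_add_right (show f a ≤ f b from hab) (f c))
    toSyn := AddEquiv.refl _
    toSyn_monotone := by
      intro a b hab
      obtain ⟨c, rfl⟩ := exists_add_of_le hab
      change f a ≤ f (a + c)
      rw [map_add]
      exact le_add_of_nonneg_right (h0 c)
    wellFoundedLT_syn := ⟨InvImage.wf f wellFounded_lt⟩ }

theorem MonomialOrder.lift_lt_iff {ι : Type} {N : Type} [AddCommMonoid N] [LinearOrder N]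
    [IsOrderedAddMonoid N] [WellFoundedLT N] (f : (ι →₀ ℕ) →+ N) (hf : Function.Injective f)
    (h0 : ∀ u, 0 ≤ f u) (u v : ι →₀ ℕ) :
    (MonomialOrder.lift f hf h0).toSyn u < (MonomialOrder.lift f hf h0).toSyn v ↔ f u < f v := by
  rfl

/-- Compare first by the value of an additive map in a well-ordered monoid, then by `ord`. -/
theorem MonomialOrder.exists_refine {ι : Type} {N : Type} [AddCommMonoid N] [LinearOrder N]
    [IsOrderedCancelAddMonoid N] [WellFoundedLT N] (f : (ι →₀ ℕ) →+ N) (h0 : ∀ u, 0 ≤ f u)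
    (ord : MonomialOrder.{0, 0} ι) : ∃ ord' : MonomialOrder.{0, 0} ι, ∀ u v,
      ord'.toSyn u < ord'.toSyn v ↔ f u < f v ∨ f u = f v ∧ ord.toSyn u < ord.toSyn v := by
  let g : (ι →₀ ℕ) →+ N ×ₗ ord.syn :=
    { toFun := fun u => toLex (f u, ord.toSyn u)
      map_zero' := by simp only [map_zero]; rfl
      map_add' := fun u v => by simp only [map_add]; rfl }
  have hg : Function.Injective g := fun u v h =>
    ord.toSyn.injective (congrArg (fun x => (ofLex x).2) h)
  have hg0 : ∀ u, 0 ≤ g u := fun u =>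
    Prod.Lex.toLex_mono (show ((0, 0) : N × ord.syn) ≤ (f u, ord.toSyn u) from
      ⟨h0 u, ord.zero_le _⟩)
  exact ⟨MonomialOrder.lift g hg hg0, fun u v =>
    (MonomialOrder.lift_lt_iff g hg hg0 u v).trans Prod.Lex.toLex_lt_toLex⟩

theorem MonomialOrder.nonempty_of_finite (ι : Type) [Finite ι] :
    Nonempty (MonomialOrder.{0, 0} ι) := by
  obtain ⟨n, ⟨e⟩⟩ := Finite.exists_equiv_fin ι
  let _ : LinearOrder ι := LinearOrder.lift' e e.injective
  exact ⟨MonomialOrder.lex⟩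

/-- The exponent `u` is not the smallest one in its fiber under `F`. -/
def IsNonminimal {ι : Type} {M : Type*} (ord : MonomialOrder.{0, 0} ι) (F : (ι →₀ ℕ) → M)
    (u : ι →₀ ℕ) : Prop :=
  ∃ v, F v = F u ∧ ord.toSyn v < ord.toSyn u

/-- The non-minimal exponents are generated by those which satisfy `P`. -/
def IsGeneratedBy {ι : Type} {M : Type*} (P : ∀ ⦃ι : Type⦄, (ι →₀ ℕ) → Prop)
    (ord : MonomialOrder.{0, 0} ι) (F : (ι →₀ ℕ) → M) : Prop :=
  ∀ u, IsNonminimal ord F u → ∃ u' ≤ u, P u' ∧ IsNonminimal ord F u'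

theorem IsNonminimal.mono {ι M : Type} [AddCommMonoid M] {ord : MonomialOrder.{0, 0} ι}
    {F : (ι →₀ ℕ) →ₗ[ℕ] M} {u u' : ι →₀ ℕ} (h : IsNonminimal ord F u') (hu : u' ≤ u) :
    IsNonminimal ord F u := by
  obtain ⟨v, hv, hlt⟩ := h
  obtain ⟨w, rfl⟩ := exists_add_of_le hu
  refine ⟨v + w, by simp [hv], ?_⟩
  rw [map_add, map_add]
  exact add_lt_add_left hlt _

/-! ### Initial ideals of toric ideals in terms of fibers. -/

section Algebra

variable (K : Type*) [Field K] {ι κ : Type} (a : ι → κ → ℤ)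

theorem monomialHom_monomial (u : ι →₀ ℕ) (c : K) :
    monomialHom K a (MvPolynomial.monomial u c) =
      AddMonoidAlgebra.single (Finsupp.linearCombination ℕ a u) c := by
  induction u using Finsupp.induction_linear generalizing c with
  | zero => simp [monomialHom]
  | add u v hu hv =>
    rw [← mul_one c, ← MvPolynomial.monomial_mul, map_mul, hu, hv,
      AddMonoidAlgebra.single_mul_single, map_add]
  | single j n =>
    simp [monomialHom, MvPolynomial.aeval_monomial, AddMonoidAlgebra.single_mul_single]

theorem monomial_sub_monomial_mem_toricIdeal {u v : ι →₀ ℕ}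
    (h : Finsupp.linearCombination ℕ a v = Finsupp.linearCombination ℕ a u) :
    MvPolynomial.monomial u (1 : K) - MvPolynomial.monomial v 1 ∈ toricIdeal K a := by
  rw [toricIdeal, RingHom.mem_ker, map_sub]
  simp [monomialHom_monomial, h]

/-- Every other exponent of `f` is smaller than the leading one. If the latter were minimal in its
fiber, nothing could cancel the leading coefficient in the image of `f`. -/
theorem isNonminimal_degree_of_mem_toricIdeal (ord : MonomialOrder.{0, 0} ι)
    {f : MvPolynomial ι K} (hf : f ∈ toricIdeal K a) (h0 : f ≠ 0) :
    IsNonminimal ord (Finsupp.linearCombination ℕ a) (ord.degree f) := by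
  classical
  by_contra hmin
  have h1 : monomialHom K a f = 0 := hf
  rw [f.as_sum, map_sum] at h1
  simp only [monomialHom_monomial] at h1
  have h2 := DFunLike.congr_fun (congrArg AddMonoidAlgebra.coeff h1)
    (Finsupp.linearCombination ℕ a (ord.degree f))
  rw [AddMonoidAlgebra.coeff_sum, Finsupp.finsetSum_apply,
    Finset.sum_eq_single_of_mem (ord.degree f) (ord.degree_mem_support h0)] at h2
  · simp [MonomialOrder.coeff_degree_eq_zero_iff, h0] at h2
  · intro v hv hne
    rw [AddMonoidAlgebra.coeff_single]
    refine Finsupp.single_eq_of_ne' fun heq => hmin ⟨v, heq, ?_⟩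
    exact lt_of_le_of_ne (ord.le_degree hv) (ord.toSyn.injective.ne hne)

theorem leadingTerm_monomial_sub_monomial (ord : MonomialOrder.{0, 0} ι) {u v : ι →₀ ℕ}
    (h : ord.toSyn v < ord.toSyn u) :
    ord.leadingTerm (MvPolynomial.monomial u (1 : K) - MvPolynomial.monomial v 1) =
      MvPolynomial.monomial u 1 := by
  classical
  have hd : ord.toSyn (ord.degree (MvPolynomial.monomial v (1 : K))) <
      ord.toSyn (ord.degree (MvPolynomial.monomial u (1 : K))) := by
    simpa [MonomialOrder.degree_monomial] using h
  rw [MonomialOrder.leadingTerm, MonomialOrder.leadingCoeff_sub_of_lt hd,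
    MonomialOrder.degree_sub_of_lt hd]
  simp [MonomialOrder.degree_monomial]

theorem monomial_mem_initialIdeal_toricIdeal (ord : MonomialOrder.{0, 0} ι) {u : ι →₀ ℕ}
    (h : IsNonminimal ord (Finsupp.linearCombination ℕ a) u) :
    MvPolynomial.monomial u (1 : K) ∈ initialIdeal ord (toricIdeal K a) := by
  obtain ⟨v, hv, hlt⟩ := h
  exact Ideal.subset_span ⟨_, monomial_sub_monomial_mem_toricIdeal K a hv,
    (leadingTerm_monomial_sub_monomial K ord hlt).symm⟩

theorem initialIdeal_toricIdeal (ord : MonomialOrder.{0, 0} ι) :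
    initialIdeal ord (toricIdeal K a) =
      Ideal.span ((fun t => MvPolynomial.monomial t (1 : K)) ''
        {u | IsNonminimal ord (Finsupp.linearCombination ℕ a) u}) := by
  apply le_antisymm
  · rw [initialIdeal, Ideal.span_le]
    rintro g ⟨f, hf, rfl⟩
    by_cases h0 : f = 0
    · simp [h0, MonomialOrder.leadingTerm]
    · rw [MonomialOrder.leadingTerm, ← mul_one (ord.leadingCoeff f), ← MvPolynomial.C_mul_monomial]
      exact Ideal.mul_mem_left _ _ (Ideal.subset_span
        ⟨_, isNonminimal_degree_of_mem_toricIdeal K a ord hf h0, rfl⟩)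
  · rw [Ideal.span_le]
    rintro _ ⟨u, hu, rfl⟩
    exact monomial_mem_initialIdeal_toricIdeal K a ord hu

/-- The dictionary used for both conclusions, with `P` either "degree at most m" or "square-free".
-/
theorem exists_initialIdeal_toricIdeal_iff (P : ∀ ⦃ι : Type⦄, (ι →₀ ℕ) → Prop) :
    (∃ (ord : MonomialOrder.{0, 0} ι) (T : Set (ι →₀ ℕ)), (∀ t ∈ T, P t) ∧
      initialIdeal ord (toricIdeal K a) =
        Ideal.span ((fun t => MvPolynomial.monomial t (1 : K)) '' T)) ↔
    ∃ ord : MonomialOrder.{0, 0} ι, IsGeneratedBy P ord (Finsupp.linearCombination ℕ a) := by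
  classical
  refine exists_congr fun ord => ⟨?_, fun h => ?_⟩
  · rintro ⟨T, hT, hI⟩ u hu
    rw [initialIdeal_toricIdeal] at hI
    have mem : ∀ (S : Set (ι →₀ ℕ)) (x : ι →₀ ℕ), MvPolynomial.monomial x (1 : K) ∈
        Ideal.span ((fun t => MvPolynomial.monomial t (1 : K)) '' S) ↔ ∃ t ∈ S, t ≤ x := by
      intro S x
      rw [MvPolynomial.mem_ideal_span_monomial_image]
      simp [MvPolynomial.support_monomial]
    obtain ⟨t, ht, htu⟩ := (mem T u).1 (hI ▸ (mem _ u).2 ⟨u, hu, le_rfl⟩)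
    -- The generator `t` lies in the initial ideal, hence above a non-minimal exponent, so it is
    -- itself non-minimal.
    obtain ⟨s, hs, hst⟩ := (mem {u | IsNonminimal ord (Finsupp.linearCombination ℕ a) u} t).1
      (hI ▸ (mem T t).2 ⟨t, ht, le_rfl⟩)
    exact ⟨t, htu, hT t ht, IsNonminimal.mono hs hst⟩
  · refine ⟨{u | P u ∧ IsNonminimal ord (Finsupp.linearCombination ℕ a) u}, fun t ht => ht.1, ?_⟩
    rw [initialIdeal_toricIdeal]
    apply le_antisymm
    · rw [Ideal.span_le]
      rintro _ ⟨u, hu, rfl⟩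
      obtain ⟨u', hle, hP, hu'⟩ := h u hu
      obtain ⟨w, rfl⟩ := exists_add_of_le hle
      have : MvPolynomial.monomial (u' + w) (1 : K) =
          MvPolynomial.monomial w 1 * MvPolynomial.monomial u' 1 := by
        rw [MvPolynomial.monomial_mul, add_comm, one_mul]
      change MvPolynomial.monomial (u' + w) (1 : K) ∈ _
      rw [this]
      exact Ideal.mul_mem_left _ _ (Ideal.subset_span ⟨u', ⟨hP, hu'⟩, rfl⟩)
    · exact Ideal.span_mono (Set.image_mono fun u hu => hu.2)

end Algebra

/-! ### Classes of exponents that survive the transfer. -/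

/-- The properties of a class of exponents used in the transfer of initial ideals. -/
structure IsTransferable (P : ∀ ⦃ι : Type⦄, (ι →₀ ℕ) → Prop) : Prop where
  cover : ∀ {ι κ : Type} (f : (ι →₀ ℕ) →ₗ[ℕ] (κ →₀ ℕ)) (u : ι →₀ ℕ) (p : κ →₀ ℕ),
    P p → p ≤ f u → ∃ u' ≤ u, P u' ∧ p ≤ f u'
  of_mapDomain : ∀ {ι κ : Type} (e : ι → κ), Function.Injective e → ∀ u : ι →₀ ℕ,
    P (u.mapDomain e) → P u
  pair : ∀ {ι : Type} {a b : ι}, a ≠ b → P (Finsupp.single a 1 + Finsupp.single b 1)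

/-- Each unit of `p` costs at most one variable of `u`. -/
theorem exists_le_degree_le {ι κ : Type} (f : (ι →₀ ℕ) →ₗ[ℕ] (κ →₀ ℕ)) (u : ι →₀ ℕ)
    (p : κ →₀ ℕ) (hp : p ≤ f u) : ∃ u' ≤ u, u'.degree ≤ p.degree ∧ p ≤ f u' := by
  classical
  induction hn : p.degree generalizing p with
  | zero => exact ⟨0, zero_le, by simp, by simp [(Finsupp.degree_eq_zero_iff p).1 hn]⟩
  | succ n ih =>
    have hp0 : p ≠ 0 := by rintro rfl; simp at hn
    obtain ⟨t, ht⟩ := Finsupp.ne_iff.1 hp0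
    have hle : Finsupp.single t 1 ≤ p := by
      rw [Finsupp.single_le_iff]; exact Nat.one_le_iff_ne_zero.2 ht
    obtain ⟨q, rfl⟩ := exists_add_of_le hle
    obtain ⟨v, hv, hdeg, hqv⟩ := ih q (le_trans (by simp) hp) (by simp at hn; omega)
    by_cases h : Finsupp.single t 1 + q ≤ f v
    · exact ⟨v, hv, by omega, h⟩
    · obtain ⟨w, rfl⟩ := exists_add_of_le hv
      -- Only the coordinate `t` can fail, so the unused part `w` must contain a variable
      -- contributing to it.
      have ht' : f v t ≤ q t := by
        by_contra hlt
        refine h fun s => ?_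
        have := hqv s
        by_cases hs : t = s
        · subst hs; simp; omega
        · simpa [hs] using this
      have hw : f w t ≠ 0 := by
        have := hp t
        simp at this; omega
      have : ∃ b ∈ w.support, f (Finsupp.single b 1) t ≠ 0 := by
        by_contra! hcon
        apply hw
        rw [← Finsupp.sum_single w, Finsupp.sum, map_sum, Finsupp.finsetSum_apply]
        refine Finset.sum_eq_zero fun b hb => ?_
        rw [← mul_one (w b), ← smul_eq_mul, ← Finsupp.smul_single, map_smul, Finsupp.smul_apply,
          hcon b hb, smul_zero]
      obtain ⟨b, hb, hbt⟩ := this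
      refine ⟨v + Finsupp.single b 1, ?_, by simp; omega, fun s => ?_⟩
      · gcongr
        rw [Finsupp.single_le_iff]; exact Nat.one_le_iff_ne_zero.2 (Finsupp.mem_support_iff.1 hb)
      · have := hqv s
        by_cases hs : t = s
        · subst hs; simp; omega
        · simp [hs]; omega

theorem isTransferable_degree_le {m : ℕ} (hm : 2 ≤ m) :
    IsTransferable fun _ t => t.degree ≤ m where
  cover f u p hp h := by
    obtain ⟨u', h1, h2, h3⟩ := exists_le_degree_le f u p h
    exact ⟨u', h1, h2.trans hp, h3⟩
  of_mapDomain e _ u h := by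
    simpa [Finsupp.degree_mapDomain] using h
  pair _ := by simpa using hm

theorem isTransferable_squarefree :
    IsTransferable fun _ t => ∀ i, t i ≤ 1 where
  cover {ι κ} f u p hp h := by
    classical
    refine ⟨u.mapRange (min 1) (by simp), fun i => by simp, fun i => by simp, fun t => ?_⟩
    by_cases hpt : p t = 0
    · simp [hpt]
    refine (hp t).trans (Nat.one_le_iff_ne_zero.2 fun h0 => ?_)
    have hu : f u t ≠ 0 := by have := h t; omega
    -- A multiple of the truncation dominates `u`, so truncating does not shrink the support of the
    -- image; a square-free `p` sees only that support.
    have hle : ∃ n : ℕ, u ≤ n • u.mapRange (min 1) (by simp) := by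
      refine ⟨u.degree, fun i => ?_⟩
      have := Finsupp.le_degree i u
      by_cases hi : u i = 0
      · simp [hi]
      · simpa [Nat.min_eq_left (Nat.one_le_iff_ne_zero.2 hi)] using this
    obtain ⟨n, hn⟩ := hle
    obtain ⟨w, hw⟩ := exists_add_of_le hn
    have := congrArg (fun x => f x t) hw
    simp only [map_smul, map_add, Finsupp.smul_apply, Finsupp.add_apply, h0] at this
    simp only [smul_zero] at this
    omega
  of_mapDomain e he u h i := by
    simpa [Finsupp.mapDomain_apply he] using h (e i)
  pair {ι a b} hab i := by
    classical
    simp only [Finsupp.add_apply, Finsupp.single_apply]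
    split_ifs with h1 h2 <;> simp
    exact hab (h1.trans h2.symm)

/-- Passing to a subset of the variables that contains a smallest representative of every vector:
replacing each variable by its representative keeps the fiber and never increases the monomial.
Hence minimality is the same before and after restriction. -/
theorem IsGeneratedBy.restrict {P : ∀ ⦃ι : Type⦄, (ι →₀ ℕ) → Prop} (hP : IsTransferable P)
    {ι ι' M : Type} [AddCommMonoid M] {ord : MonomialOrder.{0, 0} ι} {a : ι → M}
    (h : IsGeneratedBy P ord (Finsupp.linearCombination ℕ a)) {e : ι' → ι}
    (he : Function.Injective e) (r : ι → ι') (hr : ∀ j, a (e (r j)) = a j)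
    (hle : ∀ j, ord.toSyn (Finsupp.single (e (r j)) 1) ≤ ord.toSyn (Finsupp.single j 1)) :
    ∃ ord' : MonomialOrder.{0, 0} ι',
      IsGeneratedBy P ord' (Finsupp.linearCombination ℕ fun j => a (e j)) := by
  classical
  let f : (ι' →₀ ℕ) →+ ord.syn :=
    ord.toSyn.toAddMonoidHom.comp (Finsupp.mapDomain.addMonoidHom e)
  have hf : Function.Injective f :=
    ord.toSyn.injective.comp (Finsupp.mapDomain_injective he)
  let ord' : MonomialOrder.{0, 0} ι' := MonomialOrder.lift f hf fun u => ord.zero_le _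
  have hlt : ∀ u v, ord'.toSyn u < ord'.toSyn v ↔
      ord.toSyn (u.mapDomain e) < ord.toSyn (v.mapDomain e) :=
    MonomialOrder.lift_lt_iff f hf _
  have hF : ∀ u : ι' →₀ ℕ, Finsupp.linearCombination ℕ (fun j => a (e j)) u =
      Finsupp.linearCombination ℕ a (u.mapDomain e) := fun u => by
    rw [Finsupp.linearCombination_mapDomain]; rfl
  have hred : ∀ v : ι →₀ ℕ,
      ord.toSyn ((v.mapDomain r).mapDomain e) ≤ ord.toSyn v := by
    intro v
    induction v using Finsupp.induction_linear with
    | zero => simp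
    | add v w hv hw =>
      simp only [Finsupp.mapDomain_add, map_add]
      exact add_le_add hv hw
    | single j n =>
      simp only [Finsupp.mapDomain_single]
      have := nsmul_le_nsmul_right (hle j) n
      simpa [← map_nsmul] using this
  have hFr : ∀ v : ι →₀ ℕ, Finsupp.linearCombination ℕ (fun j => a (e j)) (v.mapDomain r) =
      Finsupp.linearCombination ℕ a v := fun v => by
    rw [Finsupp.linearCombination_mapDomain]
    congr 2
    funext j
    exact hr j
  have hiff : ∀ u, IsNonminimal ord' (Finsupp.linearCombination ℕ fun j => a (e j)) u ↔
      IsNonminimal ord (Finsupp.linearCombination ℕ a) (u.mapDomain e) := by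
    refine fun u => ⟨?_, ?_⟩
    · rintro ⟨v, hv, h'⟩
      exact ⟨v.mapDomain e, by rw [← hF, ← hF, hv], (hlt _ _).1 h'⟩
    · rintro ⟨v, hv, h'⟩
      exact ⟨v.mapDomain r, by rw [hFr, hF, hv], (hlt _ _).2 ((hred v).trans_lt h')⟩
  refine ⟨ord', fun u hu => ?_⟩
  obtain ⟨u', hle', hPu, hu'⟩ := h _ ((hiff u).1 hu)
  -- A divisor of a monomial in the kept variables involves only those variables.
  have hsub : ↑u'.support ⊆ Set.range e := by
    intro j hj
    have h1 : (u.mapDomain e) j ≠ 0 := by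
      have := hle' j
      have := Finsupp.mem_support_iff.1 hj
      omega
    by_contra hj'
    exact h1 (Finsupp.mapDomain_of_notMem_range _ _ hj')
  have hu'' := Finsupp.mapDomain_comapDomain e he u' hsub
  refine ⟨u'.comapDomain e he.injOn, fun j => ?_, hP.of_mapDomain e he _ (by rwa [hu'']),
    (hiff _).2 (by rwa [hu''])⟩
  have := hle' (e j)
  rwa [Finsupp.mapDomain_apply he] at this

/-! ### Listing the factors of a monomial in order. -/

section Enumeration

theorem exists_monotone_enumeration {ι : Type} (key : ι → ℕ) (u : ι →₀ ℕ) :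
    ∃ g : Fin u.degree → ι, u = ∑ j, Finsupp.single (g j) 1 ∧ Monotone (key ∘ g) := by
  classical
  have h : ∃ g : Fin u.degree → ι, u = ∑ j, Finsupp.single (g j) 1 := by
    obtain ⟨l, hl⟩ : ∃ l : List ι, (l : Multiset ι) = Finsupp.toMultiset u := Quot.exists_rep _
    have hlen : l.length = u.degree := by
      rw [← Multiset.coe_card, hl, Finsupp.card_toMultiset]
      rfl
    rw [← hlen]
    refine ⟨fun j => l[j.1], ?_⟩
    have := congrArg List.sum (List.ofFn_getElem_eq_map l fun x => (Finsupp.single x 1 : ι →₀ ℕ))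
    rw [List.sum_ofFn] at this
    rw [this]
    apply (AddEquiv.injective Multiset.toFinsupp.symm)
    change Finsupp.toMultiset _ = Finsupp.toMultiset _
    rw [← hl]
    clear hl this hlen
    induction l with
    | nil => rfl
    | cons x l ih =>
      rw [List.map_cons, List.sum_cons, map_add, ← ih, Finsupp.toMultiset_single]
      simp
  obtain ⟨g, hg⟩ := h
  refine ⟨g ∘ Tuple.sort (key ∘ g), ?_, Tuple.monotone_sort (key ∘ g)⟩
  exact hg.trans (Equiv.sum_comp (Tuple.sort (key ∘ g)) fun j => Finsupp.single (g j) 1).symm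

theorem eq_of_monotone_of_sum_single_eq {r : ℕ} {f g : Fin r → ℕ} (hf : Monotone f)
    (hg : Monotone g)
    (h : ∑ j, Finsupp.single (f j) 1 = ∑ j, (Finsupp.single (g j) 1 : ℕ →₀ ℕ)) : f = g := by
  have h' := congrArg Finsupp.toMultiset h
  simp only [map_sum, Finsupp.toMultiset_single, one_smul] at h'
  have hm : ∀ f : Fin r → ℕ, ∑ j, ({f j} : Multiset ℕ) = (List.ofFn f : Multiset ℕ) := by
    intro f
    rw [← List.sum_ofFn, ← Function.comp_def, ← List.map_ofFn]
    induction List.ofFn f with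
    | nil => rfl
    | cons x l ih => rw [List.map_cons, List.sum_cons, ih]; rfl
  rw [hm, hm, Multiset.coe_eq_coe] at h'
  exact List.ofFn_injective (h'.eq_of_pairwise' (List.sortedLE_ofFn_iff.2 hf).pairwise
    (List.sortedLE_ofFn_iff.2 hg).pairwise)

end Enumeration

/-! ### Even distribution under capacities. -/

section Balanced

/-- The pair `(x, x')` is as evenly distributed as the capacities `α`, `α'` permit, with the first
entry preferred. -/
def IsBalanced (α α' x x' : ℕ) : Prop :=
  (x ≤ x' + 1 ∨ x' = α') ∧ (x' ≤ x ∨ x = α)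

/-- Convexity: with a fixed sum, the most even pair within the capacities has the least sum of
squares. -/
theorem IsBalanced.sq_add_sq_le {α α' x x' y y' : ℕ} (h : IsBalanced α α' y y')
    (hx : x ≤ α) (hx' : x' ≤ α') (hsum : x + x' = y + y') :
    y ^ 2 + y' ^ 2 ≤ x ^ 2 + x' ^ 2 := by
  obtain ⟨h1, h2⟩ := h
  rcases le_total x y with hxy | hxy
  · obtain ⟨e, rfl⟩ := Nat.exists_eq_add_of_le hxy
    obtain rfl : x' = y' + e := by omega
    rcases Nat.eq_zero_or_pos e with rfl | he
    · simp
    have : x + e ≤ y' + 1 := by omega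
    nlinarith
  · obtain ⟨e, rfl⟩ := Nat.exists_eq_add_of_le hxy
    obtain rfl : y' = x' + e := by omega
    rcases Nat.eq_zero_or_pos e with rfl | he
    · simp
    have : x' + e ≤ y := by omega
    nlinarith

/-- Squares cannot distinguish a pair from its swap; among ties, the balanced pair has the larger
first entry. -/
theorem IsBalanced.le_of_sq_add_sq_eq {α α' x x' y y' : ℕ} (h : IsBalanced α α' y y')
    (hx : x ≤ α) (hsum : x + x' = y + y')
    (heq : y ^ 2 + y' ^ 2 = x ^ 2 + x' ^ 2) : x ≤ y := by
  by_contra! hxy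
  obtain ⟨e, rfl⟩ := Nat.exists_eq_add_of_le hxy.le
  obtain rfl : y' = x' + e := by omega
  have : x' + e ≤ y := by have := h.2; omega
  nlinarith

/-- Two different sequences with equal sum have indices with `x j < y j` and `y k < x k`. Neither `x
j` nor `y k` is then at capacity, so balancedness bounds the gaps and gives a contradiction in
either order of `j` and `k`. -/
theorem eq_of_isBalanced {r : ℕ} {α x y : Fin r → ℕ} (hx : ∀ j, x j ≤ α j) (hy : ∀ j, y j ≤ α j)
    (bx : ∀ j k, j < k → IsBalanced (α j) (α k) (x j) (x k))
    (b_y : ∀ j k, j < k → IsBalanced (α j) (α k) (y j) (y k))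
    (h : ∑ j, x j = ∑ j, y j) : x = y := by
  by_contra hne
  have key : ∀ {x y : Fin r → ℕ}, x ≠ y → ∑ j, x j = ∑ j, y j → ∃ j, x j < y j := by
    intro x y hne h
    by_contra! hle
    exact hne (funext fun j =>
      ((Finset.sum_eq_sum_iff_of_le fun j _ => hle j).1 h.symm j (Finset.mem_univ j)).symm)
  obtain ⟨j, hj⟩ := key hne h
  obtain ⟨k, hk⟩ := key (Ne.symm hne) h.symm
  have := hx k
  have := hy j
  rcases lt_trichotomy j k with hjk | rfl | hjk
  · have := bx j k hjk
    have := b_y j k hjk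
    unfold IsBalanced at *
    omega
  · omega
  · have := bx k j hjk
    have := b_y k j hjk
    unfold IsBalanced at *
    omega

/-- The first part of the most even splitting of `T` with capacities `α` and `α'`. -/
def evenShare (α α' T : ℕ) : ℕ := min α (max ((T + 1) / 2) (T - α'))

end Balanced

/-! ### Partial sums and sorted pairs. -/

section PartialSums

variable {D : Type} {β : D → Type} [∀ i, Fintype (β i)]

/-- The degree of the exponent `a` with respect to the grading with `deg y_{i,b} = e_i`. -/
def multidegree (a : (Σ i, β i) → ℕ) (i : D) : ℕ := ∑ b, a ⟨i, b⟩

/-- The sum of the entries of `a` of colour `i` at a position smaller than `k`. -/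
def partialSum (pos : (Σ i, β i) → ℕ) (i : D) (k : ℕ) (a : (Σ i, β i) → ℕ) : ℕ :=
  ∑ b, if pos ⟨i, b⟩ < k then a ⟨i, b⟩ else 0

theorem multidegree_add (a c : (Σ i, β i) → ℕ) :
    multidegree (a + c) = multidegree a + multidegree c :=
  funext fun i => by simp [multidegree, Finset.sum_add_distrib]

variable {pos : (Σ i, β i) → ℕ} {i : D}

theorem partialSum_add (k : ℕ) (a c : (Σ i, β i) → ℕ) :
    partialSum pos i k (a + c) = partialSum pos i k a + partialSum pos i k c := by
  simp only [partialSum, ← Finset.sum_add_distrib]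
  exact Finset.sum_congr rfl fun b _ => by split_ifs <;> simp

theorem partialSum_le_multidegree (k : ℕ) (a : (Σ i, β i) → ℕ) :
    partialSum pos i k a ≤ multidegree a i :=
  Finset.sum_le_sum fun b _ => by split_ifs <;> simp

theorem partialSum_eq_multidegree {n : ℕ} (hn : ∀ y, pos y < n) (a : (Σ i, β i) → ℕ) :
    partialSum pos i n a = multidegree a i :=
  Finset.sum_congr rfl fun b _ => by simp [hn]

theorem partialSum_zero (a : (Σ i, β i) → ℕ) : partialSum pos i 0 a = 0 := by
  simp [partialSum]

theorem partialSum_succ (hpos : Function.Injective pos) (b : β i) (a : (Σ i, β i) → ℕ) :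
    partialSum pos i (pos ⟨i, b⟩ + 1) a = partialSum pos i (pos ⟨i, b⟩) a + a ⟨i, b⟩ := by
  classical
  have : a ⟨i, b⟩ = ∑ b', if b' = b then a ⟨i, b'⟩ else 0 := by simp
  rw [this, partialSum, partialSum, ← Finset.sum_add_distrib]
  refine Finset.sum_congr rfl fun b' _ => ?_
  by_cases hb : b' = b
  · subst hb; simp
  · have : pos ⟨i, b'⟩ ≠ pos ⟨i, b⟩ := fun h => hb (by simpa using hpos h)
    simp only [hb, if_false, add_zero]
    exact if_congr (by omega) rfl rfl

theorem partialSum_succ_of_forall_ne {k : ℕ} (h : ∀ b : β i, pos ⟨i, b⟩ ≠ k)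
    (a : (Σ i, β i) → ℕ) : partialSum pos i (k + 1) a = partialSum pos i k a :=
  Finset.sum_congr rfl fun b _ => if_congr (by have := h b; omega) rfl rfl

theorem eq_of_partialSum_eq (hpos : Function.Injective pos) {a c : (Σ i, β i) → ℕ}
    (h : ∀ i k, partialSum pos i k a = partialSum pos i k c) : a = c := by
  funext ⟨i, b⟩
  have h1 := partialSum_succ hpos b a
  have h2 := partialSum_succ hpos b c
  rw [h, h] at h1
  omega

/-- The pair `(a, a')` is sorted if all its partial sums are balanced. -/
def IsSorted (pos : (Σ i, β i) → ℕ) (a a' : (Σ i, β i) → ℕ) : Prop :=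
  ∀ i k, IsBalanced (multidegree a i) (multidegree a' i) (partialSum pos i k a)
    (partialSum pos i k a')

theorem IsSorted.refl (a : (Σ i, β i) → ℕ) : IsSorted pos a a :=
  fun _ _ => ⟨Or.inl (Nat.le_succ _), Or.inl le_rfl⟩

/-- Prescribe the partial sums of `c` as even shares of those of `a + a'`. The share is monotone and
grows no faster than its argument, so its increments are valid entries bounded by `a + a'`. -/
theorem exists_isSorted (hpos : Function.Injective pos) {n : ℕ} (hn : ∀ y, pos y < n)
    (a a' : (Σ i, β i) → ℕ) :
    ∃ c c' : (Σ i, β i) → ℕ, c + c' = a + a' ∧ multidegree c = multidegree a ∧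
      multidegree c' = multidegree a' ∧ IsSorted pos c c' := by
  let g : D → ℕ → ℕ := fun i => evenShare (multidegree a i) (multidegree a' i)
  let S : D → ℕ → ℕ := fun i k => partialSum pos i k (a + a')
  let c : (Σ i, β i) → ℕ := fun y => g y.1 (S y.1 (pos y + 1)) - g y.1 (S y.1 (pos y))
  have hS : ∀ i (b : β i), S i (pos ⟨i, b⟩ + 1) = S i (pos ⟨i, b⟩) + (a + a') ⟨i, b⟩ :=
    fun i b => partialSum_succ hpos b _
  have hc : ∀ y, c y ≤ (a + a') y := by
    rintro ⟨i, b⟩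
    simp only [c, g, evenShare, hS]
    omega
  have hsum : ∀ i k, partialSum pos i k c = g i (S i k) := by
    intro i k
    induction k with
    | zero => simp [partialSum_zero, S, g, evenShare]
    | succ k ih =>
      by_cases h : ∃ b : β i, pos ⟨i, b⟩ = k
      · obtain ⟨b, rfl⟩ := h
        rw [partialSum_succ hpos, ih]
        have : g i (S i (pos ⟨i, b⟩)) ≤ g i (S i (pos ⟨i, b⟩ + 1)) := by
          simp only [g, evenShare, hS]
          omega
        simp only [c]
        omega
      · push Not at h
        rw [partialSum_succ_of_forall_ne h, ih]
        simp only [S, partialSum_succ_of_forall_ne h]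
  obtain ⟨c', hc'⟩ : ∃ c', c + c' = a + a' := by
    obtain ⟨c', h⟩ := exists_add_of_le (show c ≤ a + a' from hc)
    exact ⟨c', h.symm⟩
  have hdeg : multidegree c = multidegree a := by
    funext i
    rw [← partialSum_eq_multidegree hn c, hsum]
    simp only [g, evenShare, S, partialSum_eq_multidegree hn, multidegree_add, Pi.add_apply]
    omega
  have hdeg' : multidegree c' = multidegree a' := by
    have := congrArg multidegree hc'
    rw [multidegree_add, multidegree_add, hdeg] at this
    exact add_left_cancel this
  refine ⟨c, c', hc', hdeg, hdeg', fun i k => ?_⟩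
  have h1 : partialSum pos i k c + partialSum pos i k c' = S i k := by
    rw [← partialSum_add, hc']
  have h2 : S i k ≤ multidegree a i + multidegree a' i := by
    have := partialSum_le_multidegree (pos := pos) (i := i) k (a + a')
    rwa [multidegree_add] at this
  have h3 : partialSum pos i k c = evenShare (multidegree a i) (multidegree a' i) (S i k) :=
    hsum i k
  rw [hdeg, hdeg']
  unfold evenShare at h3
  unfold IsBalanced
  omega

end PartialSums

/-! ### The sorting order. -/

section SortingOrder

variable {D : Type} [Fintype D] {β : D → Type} [∀ i, Fintype (β i)]

/-- The sum of the values of `φ` at all partial sums of `a` at positions up to `n`. -/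
def partialSumTotal (pos : (Σ i, β i) → ℕ) (n : ℕ) (φ : ℕ → ℕ) (a : (Σ i, β i) → ℕ) : ℕ :=
  ∑ t ∈ Finset.univ ×ˢ Finset.range (n + 1), φ (partialSum pos t.1 t.2 a)

/-- Sorting lowers the total of squares. If it does not, every partial sum of `a` is at most that of
`c`; equality throughout would force `a = c`, so that the pair was sorted already. -/
theorem exists_partialSumTotal_lt {pos : (Σ i, β i) → ℕ} (hpos : Function.Injective pos) {n : ℕ}
    (hn : ∀ y, pos y < n) {a a' : (Σ i, β i) → ℕ} (h : ¬ IsSorted pos a a') :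
    ∃ c c' : (Σ i, β i) → ℕ, c + c' = a + a' ∧ multidegree c = multidegree a ∧
      multidegree c' = multidegree a' ∧
      (partialSumTotal pos n (· ^ 2) c + partialSumTotal pos n (· ^ 2) c' <
          partialSumTotal pos n (· ^ 2) a + partialSumTotal pos n (· ^ 2) a' ∨
        partialSumTotal pos n (· ^ 2) c + partialSumTotal pos n (· ^ 2) c' =
          partialSumTotal pos n (· ^ 2) a + partialSumTotal pos n (· ^ 2) a' ∧
        partialSumTotal pos n id a < partialSumTotal pos n id c) := by
  obtain ⟨c, c', hadd, hdeg, hdeg', hsort⟩ := exists_isSorted hpos hn a a'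
  refine ⟨c, c', hadd, hdeg, hdeg', ?_⟩
  have hS : ∀ i k, partialSum pos i k a + partialSum pos i k a' =
      partialSum pos i k c + partialSum pos i k c' := fun i k => by
    rw [← partialSum_add, ← partialSum_add, hadd]
  have hB : ∀ i k, IsBalanced (multidegree a i) (multidegree a' i) (partialSum pos i k c)
      (partialSum pos i k c') := fun i k => by
    have := hsort i k
    rwa [hdeg, hdeg'] at this
  have hsq : ∀ t ∈ (Finset.univ : Finset D) ×ˢ Finset.range (n + 1),
      partialSum pos t.1 t.2 c ^ 2 + partialSum pos t.1 t.2 c' ^ 2 ≤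
        partialSum pos t.1 t.2 a ^ 2 + partialSum pos t.1 t.2 a' ^ 2 := fun t _ =>
    (hB t.1 t.2).sq_add_sq_le (partialSum_le_multidegree _ _) (partialSum_le_multidegree _ _)
      (hS _ _)
  simp only [partialSumTotal, ← Finset.sum_add_distrib, id]
  rcases (Finset.sum_le_sum hsq).lt_or_eq with hlt | heq
  · exact Or.inl hlt
  refine Or.inr ⟨heq, ?_⟩
  have heq' := (Finset.sum_eq_sum_iff_of_le hsq).1 heq
  have hle : ∀ t ∈ (Finset.univ : Finset D) ×ˢ Finset.range (n + 1),
      partialSum pos t.1 t.2 a ≤ partialSum pos t.1 t.2 c := fun t ht =>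
    (hB t.1 t.2).le_of_sq_add_sq_eq (partialSum_le_multidegree _ _) (hS _ _) (heq' t ht)
  refine (Finset.sum_le_sum hle).lt_of_ne fun hne => h ?_
  have hne' := (Finset.sum_eq_sum_iff_of_le hle).1 hne
  obtain rfl : a = c := eq_of_partialSum_eq hpos fun i k => by
    rcases le_or_gt n k with hk | hk
    -- Beyond `n` the partial sums are full multidegrees, which agree.
    · rw [partialSum_eq_multidegree fun y => (hn y).trans_le hk,
        partialSum_eq_multidegree fun y => (hn y).trans_le hk, hdeg]
    · exact hne' (i, k) (by simp; omega)
  obtain rfl : c' = a' := add_left_cancel hadd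
  exact hsort

/-- The exponent in the variables `y_{i,b}` of the image of a monomial whose variables are
indexed by exponents. -/
noncomputable def prodExponent (E : Set ((Σ i, β i) → ℕ)) : (E →₀ ℕ) →ₗ[ℕ] ((Σ i, β i) →₀ ℕ) :=
  Finsupp.linearCombination ℕ fun a : E => Finsupp.equivFunOnFinite.symm a.1

variable {E : Set ((Σ i, β i) → ℕ)}

theorem prodExponent_single (a : E) :
    prodExponent E (Finsupp.single a 1) = Finsupp.equivFunOnFinite.symm a.1 := by
  simp [prodExponent]

theorem partialSum_prodExponent_sum (pos : (Σ i, β i) → ℕ) (i : D) (k : ℕ) {r : ℕ}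
    (g : Fin r → E) :
    partialSum pos i k (prodExponent E (∑ j, Finsupp.single (g j) 1)) =
      ∑ j, partialSum pos i k (g j).1 := by
  simp only [map_sum, prodExponent_single]
  have : ((∑ j, Finsupp.equivFunOnFinite.symm (g j).1 : (Σ i, β i) →₀ ℕ) : (Σ i, β i) → ℕ) =
      ∑ j, (g j).1 := by
    ext y
    simp [Finsupp.finsetSum_apply]
  rw [this]
  simp only [partialSum, Finset.sum_apply]
  rw [Finset.sum_comm]
  refine Finset.sum_congr rfl fun b _ => ?_
  split_ifs <;> simp

/-- List the factors of both monomials by `key`. Equal rank multisets give equal multidegrees factor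
by factor, and the common product gives equal totals of each partial sum. Balanced sequences with
the same capacities and total coincide. -/
theorem eq_of_forall_isSorted {pos : (Σ i, β i) → ℕ} (hpos : Function.Injective pos)
    {rank key : E → ℕ}
    (hrank : ∀ a a', rank a = rank a' → multidegree a.1 = multidegree a'.1)
    (hkey : ∀ a a', key a ≤ key a' → rank a ≤ rank a') {u v : E →₀ ℕ}
    (hu : ∀ a a', a ≠ a' → Finsupp.single a 1 + Finsupp.single a' 1 ≤ u → key a ≤ key a' →
      IsSorted pos a.1 a'.1)
    (hv : ∀ a a', a ≠ a' → Finsupp.single a 1 + Finsupp.single a' 1 ≤ v → key a ≤ key a' →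
      IsSorted pos a.1 a'.1)
    (hprod : prodExponent E u = prodExponent E v) (hr : u.mapDomain rank = v.mapDomain rank) :
    u = v := by
  classical
  have hdeg : u.degree = v.degree := by
    rw [← Finsupp.degree_mapDomain rank u, hr, Finsupp.degree_mapDomain]
  have main : ∀ {r : ℕ} {u : E →₀ ℕ}, u.degree = r → (∀ a a', a ≠ a' →
      Finsupp.single a 1 + Finsupp.single a' 1 ≤ u → key a ≤ key a' →
      IsSorted pos a.1 a'.1) → ∃ g : Fin r → E, u = ∑ j, Finsupp.single (g j) 1 ∧
      Monotone (rank ∘ g) ∧ ∀ j k, j < k → IsSorted pos (g j).1 (g k).1 := by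
    rintro _ u rfl hu
    obtain ⟨g, hg, hmono⟩ := exists_monotone_enumeration key u
    refine ⟨g, hg, fun j k hjk => hkey _ _ (hmono hjk), fun j k hjk => ?_⟩
    by_cases heq : g j = g k
    · rw [heq]; exact IsSorted.refl _
    refine hu _ _ heq ?_ (hmono hjk.le)
    rw [← Finset.sum_pair hjk.ne (f := fun j => (Finsupp.single (g j) 1 : E →₀ ℕ))]
    exact (Finset.sum_le_sum_of_subset (Finset.subset_univ _)).trans_eq hg.symm
  obtain ⟨g, hg, gmono, gsort⟩ := main hdeg hu
  obtain ⟨g', hg', gmono', gsort'⟩ := main rfl hv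
  generalize v.degree = r at *
  subst hg hg'
  simp only [Finsupp.mapDomain_finsetSum, Finsupp.mapDomain_single] at hr
  have hrk := eq_of_monotone_of_sum_single_eq gmono gmono' hr
  have hmd : ∀ j, multidegree (g j).1 = multidegree (g' j).1 := fun j =>
    hrank _ _ (congrFun hrk j)
  refine Finset.sum_congr rfl fun j _ => ?_
  congr 1
  refine Subtype.ext (eq_of_partialSum_eq hpos fun i k => ?_)
  refine congrFun (eq_of_isBalanced (α := fun j => multidegree (g j).1 i)
    (x := fun j => partialSum pos i k (g j).1) (y := fun j => partialSum pos i k (g' j).1)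
    (fun j => partialSum_le_multidegree _ _)
    (fun j => by simpa only [hmd] using partialSum_le_multidegree _ _)
    (fun j l hjl => gsort j l hjl i k)
    (fun j l hjl => by simpa only [hmd] using gsort' j l hjl i k) ?_) j
  rw [← partialSum_prodExponent_sum, ← partialSum_prodExponent_sum, hprod]

/-- The sorting order: among the monomials with the same product and the same multiset of
degrees, the smallest one is characterized by its pairs of distinct variables. -/
theorem exists_sorting_order [Finite E]
    (hE : ∀ a ∈ E, ∀ c : (Σ i, β i) → ℕ, multidegree c = multidegree a → c ∈ E) {X : Type}
    [Countable X] (ρ : E → X)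
    (hρ : ∀ a a', ρ a = ρ a' ↔ multidegree a.1 = multidegree a'.1) :
    ∃ ord : MonomialOrder.{0, 0} E, ∀ u,
      IsNonminimal ord (fun u => (prodExponent E u, u.mapDomain ρ)) u →
      ∃ a a', a ≠ a' ∧ Finsupp.single a 1 + Finsupp.single a' 1 ≤ u ∧
        IsNonminimal ord (fun u => (prodExponent E u, u.mapDomain ρ))
          (Finsupp.single a 1 + Finsupp.single a' 1) := by
  classical
  obtain ⟨n, ⟨e⟩⟩ := Finite.exists_equiv_fin (Σ i, β i)
  let pos : (Σ i, β i) → ℕ := fun y => e y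
  have hpos : Function.Injective pos := Fin.val_injective.comp e.injective
  have hn : ∀ y, pos y < n := fun y => (e y).2
  obtain ⟨rk, hrk⟩ := exists_injective_nat X
  let f : E → ℕ := fun a => partialSumTotal pos n id a.1
  let w : E → ℕ := fun a => partialSumTotal pos n (· ^ 2) a.1
  obtain ⟨N, hN⟩ : ∃ N, ∀ a, f a < N := by
    obtain ⟨N, hN⟩ := (Set.finite_range f).bddAbove
    exact ⟨N + 1, fun a => Nat.lt_succ_of_le (hN ⟨a, rfl⟩)⟩
  -- Since `0 < N - f a ≤ N`, the key orders first by degree and then by decreasing `f`.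
  let key : E → ℕ := fun a => N * rk (ρ a) + (N - f a)
  obtain ⟨C, hC⟩ : ∃ C, ∀ a, key a ^ 2 ≤ C := by
    obtain ⟨C, hC⟩ := (Set.finite_range fun a => key a ^ 2).bddAbove
    exact ⟨C, fun a => hC ⟨a, rfl⟩⟩
  obtain ⟨ord₀⟩ := MonomialOrder.nonempty_of_finite E
  -- For a fixed number of factors, a smaller total of `C - key²` means a larger total of `key²`;
  -- this breaks ties left by the weight `w`.
  obtain ⟨ord₁, h₁⟩ := MonomialOrder.exists_refine
    (Finsupp.linearCombination ℕ fun a => C - key a ^ 2).toAddMonoidHom (fun u => Nat.zero_le _)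
    ord₀
  obtain ⟨ord, h₂⟩ := MonomialOrder.exists_refine
    (Finsupp.linearCombination ℕ w).toAddMonoidHom (fun u => Nat.zero_le _) ord₁
  refine ⟨ord, ?_⟩
  set F : (E →₀ ℕ) → ((Σ i, β i) →₀ ℕ) × (X →₀ ℕ) :=
    fun u => (prodExponent E u, u.mapDomain ρ) with hF
  have hpair : ∀ a a' : E, key a ≤ key a' → ¬ IsSorted pos a.1 a'.1 →
      IsNonminimal ord F (Finsupp.single a 1 + Finsupp.single a' 1) := by
    intro a a' hk hs
    obtain ⟨c, c', hadd, hc, hc', hlt⟩ := exists_partialSumTotal_lt hpos hn hs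
    let c₁ : E := ⟨c, hE a a.2 c hc⟩
    let c₁' : E := ⟨c', hE a' a'.2 c' hc'⟩
    have hρc : ρ c₁ = ρ a := (hρ _ _).2 hc
    have hρc' : ρ c₁' = ρ a' := (hρ _ _).2 hc'
    refine ⟨Finsupp.single c₁ 1 + Finsupp.single c₁' 1, ?_, ?_⟩
    · refine Prod.ext ?_ ?_
      · change prodExponent E _ = prodExponent E _
        rw [map_add, map_add]
        simp only [prodExponent_single]
        ext y
        exact congrFun hadd y
      · simp [hF, Finsupp.mapDomain_add, Finsupp.mapDomain_single, hρc, hρc']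
    · rw [h₂]
      refine hlt.imp (fun h => ?_) fun h => ⟨?_, (h₁ _ _).2 (Or.inl ?_)⟩
      · simpa using h
      · simpa using h.1
      · have hf : f c₁ + f c₁' = f a + f a' := by
          simp only [f, partialSumTotal, id, ← Finset.sum_add_distrib, ← partialSum_add]
          simp only [c₁, c₁', hadd]
        have hfc : f a < f c₁ := h.2
        have h1 := hN a
        have h2 := hN a'
        have h3 := hN c₁
        have h4 := hN c₁'
        have hks : key c₁ + key c₁' = key a + key a' := by
          simp only [key, hρc, hρc']
          omega
        have hkc : key c₁ < key a := by
          simp only [key, hρc]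
          omega
        -- The key sum is unchanged, but the smaller key went down, so the keys spread apart and the
        -- squares grow.
        have hsq : key a ^ 2 + key a' ^ 2 < key c₁ ^ 2 + key c₁' ^ 2 := by
          obtain ⟨x, hx⟩ := Nat.exists_eq_add_of_lt hkc
          have : key c₁' = key a' + (x + 1) := by omega
          rw [this]
          nlinarith
        have := hC a
        have := hC a'
        have := hC c₁
        have := hC c₁'
        simp only [LinearMap.toAddMonoidHom_coe, map_add, Finsupp.linearCombination_single,
          one_smul]
        omega
  intro u hu
  by_contra! hcon
  have hsorted : ∀ a a', a ≠ a' → Finsupp.single a 1 + Finsupp.single a' 1 ≤ u →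
      key a ≤ key a' → IsSorted pos a.1 a'.1 := fun a a' hne hle hk => by
    by_contra hs
    exact hcon a a' hne hle (hpair a a' hk hs)
  obtain ⟨v, hv, hmin⟩ := WellFounded.has_min
    (InvImage.wf ord.toSyn (wellFounded_lt (α := ord.syn))) {v | F v = F u} ⟨u, rfl⟩
  -- Both are pairwise sorted: `u` by assumption, `v` because replacing an unsorted pair would lower
  -- it within its fiber.
  have hvu : v = u := by
    refine eq_of_forall_isSorted hpos (rank := fun a => rk (ρ a)) (key := key)
      (fun a a' h => (hρ _ _).1 (hrk h)) (fun a a' h => ?_) (fun a a' hne hle hk => ?_) hsorted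
      (congrArg Prod.fst hv) ?_
    · by_contra! hlt
      have h1 : N * (rk (ρ a') + 1) ≤ N * rk (ρ a) := Nat.mul_le_mul_left _ hlt
      have h2 := hN a
      simp only [key] at h
      rw [Nat.mul_add] at h1
      omega
    · by_contra hs
      obtain ⟨x, hx, hlt⟩ := hpair a a' hk hs
      obtain ⟨y, rfl⟩ := exists_add_of_le hle
      refine hmin (x + y) ?_ ?_
      · refine Eq.trans ?_ hv
        have h1 := congrArg Prod.fst hx
        have h2 := congrArg Prod.snd hx
        simp only [hF] at h1 h2 ⊢
        rw [map_add, map_add, Finsupp.mapDomain_add, Finsupp.mapDomain_add, h1, h2]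
      · change ord.toSyn _ < ord.toSyn _
        rw [map_add ord.toSyn x, map_add ord.toSyn _ y]
        exact add_lt_add_left hlt _
    · have := congrArg (Finsupp.mapDomain rk) (congrArg Prod.snd hv)
      simp only [hF, ← Finsupp.mapDomain_comp] at this
      exact this
  obtain ⟨x, hx, hlt⟩ := hu
  exact hmin x hx (hvu ▸ hlt)

end SortingOrder

/-! ### Splitting a monomial by multidegree. -/

section Lifting

theorem exists_le_sum_eq {β : Type} [Fintype β] (p : β → ℕ) {m : ℕ} (h : m ≤ ∑ b, p b) :
    ∃ c ≤ p, ∑ b, c b = m := by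
  classical
  induction m with
  | zero => exact ⟨0, fun b => Nat.zero_le _, by simp⟩
  | succ m ih =>
    obtain ⟨c, hc, hm⟩ := ih (Nat.le_of_succ_le h)
    obtain ⟨b, -, hb⟩ := Finset.exists_lt_of_sum_lt (hm.trans_lt h)
    refine ⟨c + Pi.single b 1, fun b' => ?_, ?_⟩
    · have := hc b'
      by_cases hbb : b' = b
      · subst hbb; simpa using hb
      · simpa [hbb] using this
    · simp [Finset.sum_add_distrib, hm]

variable {D : Type} {β : D → Type} [∀ i, Fintype (β i)]

theorem exists_add_eq_multidegree_eq (p : (Σ i, β i) → ℕ) {m : D → ℕ} (h : m ≤ multidegree p) :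
    ∃ c c', c + c' = p ∧ multidegree c = m := by
  choose c hc hm using fun i => exists_le_sum_eq (fun b => p ⟨i, b⟩) (h i)
  obtain ⟨c', hc'⟩ := exists_add_of_le (show (fun y : Σ i, β i => c y.1 y.2) ≤ p from
    fun y => hc y.1 y.2)
  exact ⟨_, c', hc'.symm, funext hm⟩

end Lifting

/-! ### Lifting the two shadows and combining the orders. -/

section Nested

variable {D : Type} [Fintype D] {β : D → Type} [∀ i, Fintype (β i)]
  {E : Set ((Σ i, β i) → ℕ)} {A : Set (D → ℤ)}

theorem finite_of_multidegree_mem (hfin : A.Finite)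
    (hEA : ∀ a, a ∈ E ↔ (fun i => (multidegree a i : ℤ)) ∈ A) : E.Finite := by
  classical
  refine (hfin.biUnion fun α _ =>
    Set.finite_Icc 0 (fun y : Σ i, β i => (α y.1).toNat)).subset fun a ha => ?_
  refine Set.mem_biUnion ((hEA a).1 ha) ⟨fun y => Nat.zero_le _, fun y => ?_⟩
  simp only [Int.toNat_natCast]
  exact Finset.single_le_sum (f := fun b => a ⟨y.1, b⟩) (fun _ _ => Nat.zero_le _)
    (Finset.mem_univ y.2)

/-- The degree of an exponent, as an element of the configuration. -/
def degreeIn (hEA : ∀ a, a ∈ E ↔ (fun i => (multidegree a i : ℤ)) ∈ A) (a : E) : A :=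
  ⟨_, (hEA a).1 a.2⟩

theorem multidegree_prodExponent (hEA : ∀ a, a ∈ E ↔ (fun i => (multidegree a i : ℤ)) ∈ A)
    (u : E →₀ ℕ) : (fun i => (multidegree (prodExponent E u) i : ℤ)) =
      Finsupp.linearCombination ℕ (fun α : A => (α : D → ℤ)) (u.mapDomain (degreeIn hEA)) := by
  induction u using Finsupp.induction_linear with
  | zero => funext i; simp [multidegree]
  | add u v hu hv =>
    rw [map_add, Finsupp.mapDomain_add, map_add, ← hu, ← hv, Finsupp.coe_add, multidegree_add]
    funext i
    simp
  | single a n =>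
    rw [← mul_one n, ← smul_eq_mul, ← Finsupp.smul_single, map_smul, Finsupp.mapDomain_smul,
      map_smul, prodExponent_single, Finsupp.mapDomain_single]
    funext i
    simp [multidegree, degreeIn, Finset.mul_sum]

/-- Any y-monomial of the right multidegree splits into factors whose degrees are the prescribed
elements of A, counted with multiplicity. Nonnegativity of A lets the factors be split off, and E
contains every exponent of admissible degree. -/
theorem exists_prodExponent_eq (hEA : ∀ a, a ∈ E ↔ (fun i => (multidegree a i : ℤ)) ∈ A)
    (hA : ∀ a ∈ A, ∀ i, 0 ≤ a i) (q : A →₀ ℕ) (p : (Σ i, β i) →₀ ℕ)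
    (h : (fun i => (multidegree p i : ℤ)) =
      Finsupp.linearCombination ℕ (fun α : A => (α : D → ℤ)) q) :
    ∃ v : E →₀ ℕ, prodExponent E v = p ∧ v.mapDomain (degreeIn hEA) = q := by
  have hzero : ∀ p : (Σ i, β i) →₀ ℕ, (∀ i, multidegree p i = 0) → p = 0 := by
    intro p hp
    ext ⟨i, b⟩
    exact (Finset.sum_eq_zero_iff.1 (hp i)) b (Finset.mem_univ b)
  have hnonneg : ∀ (q : A →₀ ℕ) i,
      0 ≤ Finsupp.linearCombination ℕ (fun α : A => (α : D → ℤ)) q i := by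
    intro q i
    rw [Finsupp.linearCombination_apply, Finsupp.sum, Finset.sum_apply]
    exact Finset.sum_nonneg fun α _ => by
      simpa using mul_nonneg (Int.natCast_nonneg (q α)) (hA α α.2 i)
  have hadd : ∀ q₁ q₂ : A →₀ ℕ,
      (∀ p : (Σ i, β i) →₀ ℕ, (fun i => (multidegree p i : ℤ)) =
        Finsupp.linearCombination ℕ (fun α : A => (α : D → ℤ)) q₁ →
        ∃ v : E →₀ ℕ, prodExponent E v = p ∧ v.mapDomain (degreeIn hEA) = q₁) →
      (∀ p : (Σ i, β i) →₀ ℕ, (fun i => (multidegree p i : ℤ)) =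
        Finsupp.linearCombination ℕ (fun α : A => (α : D → ℤ)) q₂ →
        ∃ v : E →₀ ℕ, prodExponent E v = p ∧ v.mapDomain (degreeIn hEA) = q₂) →
      ∀ p : (Σ i, β i) →₀ ℕ, (fun i => (multidegree p i : ℤ)) =
        Finsupp.linearCombination ℕ (fun α : A => (α : D → ℤ)) (q₁ + q₂) →
        ∃ v : E →₀ ℕ, prodExponent E v = p ∧ v.mapDomain (degreeIn hEA) = q₁ + q₂ := by
    intro q₁ q₂ h₁ h₂ p h
    rw [map_add] at h
    obtain ⟨c, c', hcc, hc⟩ := exists_add_eq_multidegree_eq (p : (Σ i, β i) → ℕ)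
      (m := fun i => (Finsupp.linearCombination ℕ (fun α : A => (α : D → ℤ)) q₁ i).toNat)
      (fun i => by
        have := congrFun h i
        have := hnonneg q₁ i
        have := hnonneg q₂ i
        simp only [Pi.add_apply] at *
        omega)
    have hc₁ : (fun i => (multidegree c i : ℤ)) =
        Finsupp.linearCombination ℕ (fun α : A => (α : D → ℤ)) q₁ := by
      funext i
      rw [hc]
      exact Int.toNat_of_nonneg (hnonneg q₁ i)
    have hc₂ : (fun i => (multidegree c' i : ℤ)) =
        Finsupp.linearCombination ℕ (fun α : A => (α : D → ℤ)) q₂ := by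
      rw [← hcc, multidegree_add, ← hc₁] at h
      funext i
      have := congrFun h i
      simp only [Pi.add_apply] at this
      omega
    obtain ⟨v₁, hv₁, hq₁⟩ := h₁ (Finsupp.equivFunOnFinite.symm c) hc₁
    obtain ⟨v₂, hv₂, hq₂⟩ := h₂ (Finsupp.equivFunOnFinite.symm c') hc₂
    refine ⟨v₁ + v₂, ?_, by rw [Finsupp.mapDomain_add, hq₁, hq₂]⟩
    rw [map_add, hv₁, hv₂]
    ext y
    exact congrFun hcc y
  have hz : ∀ p : (Σ i, β i) →₀ ℕ, (fun i => (multidegree p i : ℤ)) =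
      Finsupp.linearCombination ℕ (fun α : A => (α : D → ℤ)) 0 →
      ∃ v : E →₀ ℕ, prodExponent E v = p ∧ v.mapDomain (degreeIn hEA) = 0 := by
    intro p h
    refine ⟨0, ?_, by simp⟩
    rw [hzero p fun i => by simpa using congrFun h i, map_zero]
  induction q using Finsupp.induction_linear generalizing p with
  | zero => exact hz p h
  | add q₁ q₂ h₁ h₂ => exact hadd q₁ q₂ h₁ h₂ p h
  | single α n =>
    induction n generalizing p with
    | zero =>
      rw [Finsupp.single_zero] at h ⊢
      exact hz p h
    | succ n ih =>
      rw [Finsupp.single_add] at h ⊢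
      refine hadd _ _ ih (fun p h => ?_) p h
      rw [Finsupp.linearCombination_single, one_smul] at h
      refine ⟨Finsupp.single ⟨p, (hEA _).2 (h ▸ α.2)⟩ 1, ?_, ?_⟩
      · rw [prodExponent_single]
        ext y
        rfl
      · rw [Finsupp.mapDomain_single]
        congr 1
        exact Subtype.ext h

/-- Transfer of a class of generators of initial ideals to generalized nested configurations, in
terms of fibers of exponents. -/
theorem exists_isGeneratedBy_prodExponent {P : ∀ ⦃ι : Type⦄, (ι →₀ ℕ) → Prop}
    (hP : IsTransferable P) (hfin : A.Finite) (hA : ∀ a ∈ A, ∀ i, 0 ≤ a i)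
    (hEA : ∀ a, a ∈ E ↔ (fun i => (multidegree a i : ℤ)) ∈ A) {M : Type} [AddCommMonoid M]
    (F : ((Σ i, β i) →₀ ℕ) →ₗ[ℕ] M) (hF : ∀ p q, F p = F q → multidegree p = multidegree q)
    {ordB : MonomialOrder.{0, 0} (Σ i, β i)} (genB : IsGeneratedBy P ordB F)
    {ordA : MonomialOrder.{0, 0} A}
    (genA : IsGeneratedBy P ordA (Finsupp.linearCombination ℕ fun α : A => (α : D → ℤ))) :
    ∃ ord : MonomialOrder.{0, 0} E, IsGeneratedBy P ord (F ∘ₗ prodExponent E) := by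
  classical
  have : Finite E := finite_of_multidegree_mem hfin hEA
  have : Finite A := hfin
  obtain ⟨ord₀, h₀⟩ := exists_sorting_order (E := E)
    (fun a ha c hc => (hEA c).2 (by rw [hc]; exact (hEA a).1 ha)) (degreeIn hEA)
    (fun a a' => by simp [degreeIn, funext_iff])
  obtain ⟨ord₁, h₁⟩ := MonomialOrder.exists_refine
    (ordA.toSyn.toAddMonoidHom.comp (Finsupp.mapDomain.addMonoidHom (degreeIn hEA)))
    (fun u => ordA.zero_le _) ord₀
  obtain ⟨ord, h₂⟩ := MonomialOrder.exists_refine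
    (ordB.toSyn.toAddMonoidHom.comp (prodExponent E).toAddMonoidHom)
    (fun u => ordB.zero_le _) ord₁
  have ltB : ∀ {u v : E →₀ ℕ},
      ordB.toSyn (prodExponent E u) < ordB.toSyn (prodExponent E v) →
      ord.toSyn u < ord.toSyn v := fun h => (h₂ _ _).2 (Or.inl h)
  have ltA : ∀ {u v : E →₀ ℕ}, prodExponent E u = prodExponent E v →
      ordA.toSyn (u.mapDomain (degreeIn hEA)) < ordA.toSyn (v.mapDomain (degreeIn hEA)) →
      ord.toSyn u < ord.toSyn v := fun h h' =>
    (h₂ _ _).2 (Or.inr ⟨congrArg ordB.toSyn h, (h₁ _ _).2 (Or.inl h')⟩)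
  refine ⟨ord, fun u hu => ?_⟩
  by_cases hB : IsNonminimal ordB F (prodExponent E u)
  · obtain ⟨p, hpu, hPp, q, hq, hlt⟩ := genB _ hB
    obtain ⟨u', hu', hPu', hp⟩ := hP.cover (prodExponent E) u p hPp hpu
    refine ⟨u', hu', hPu', ?_⟩
    obtain ⟨r, hr⟩ := exists_add_of_le hp
    have hFr : F (q + r) = F (prodExponent E u') := by rw [hr, map_add, map_add, hq]
    -- By `hF` the smaller product has the multidegree of the old one, so it can be lifted with the
    -- same degrees.
    obtain ⟨v, hv, -⟩ := exists_prodExponent_eq hEA hA (u'.mapDomain (degreeIn hEA)) (q + r)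
      (by rw [hF _ _ hFr, multidegree_prodExponent hEA])
    refine ⟨v, by simp [hv, hFr], ltB ?_⟩
    rw [hv, hr, map_add, map_add]
    exact add_lt_add_left hlt _
  by_cases hA' : IsNonminimal ordA (Finsupp.linearCombination ℕ fun α : A => (α : D → ℤ))
      (u.mapDomain (degreeIn hEA))
  · obtain ⟨p, hpu, hPp, hp⟩ := genA _ hA'
    obtain ⟨u', hu', hPu', hpu'⟩ := hP.cover (Finsupp.lmapDomain ℕ ℕ (degreeIn hEA)) u p hPp hpu
    refine ⟨u', hu', hPu', ?_⟩
    obtain ⟨q, hq, hlt⟩ := hp.mono hpu'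
    obtain ⟨v, hv, hvq⟩ := exists_prodExponent_eq hEA hA q (prodExponent E u')
      (by rw [hq, multidegree_prodExponent hEA]; rfl)
    exact ⟨v, by simp [hv], ltA hv (by rw [hvq]; exact hlt)⟩
  · obtain ⟨v, hv, hlt⟩ := hu
    have hvB : prodExponent E v = prodExponent E u := by
      rcases (h₂ _ _).1 hlt with h | ⟨h, -⟩
      · exact absurd ⟨_, hv, h⟩ hB
      · exact ordB.toSyn.injective h
    have hlt₁ : ord₁.toSyn v < ord₁.toSyn u := by
      rcases (h₂ _ _).1 hlt with h | ⟨-, h⟩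
      · exact absurd ⟨_, hv, h⟩ hB
      · exact h
    have hlt₀ : v.mapDomain (degreeIn hEA) = u.mapDomain (degreeIn hEA) ∧
        ord₀.toSyn v < ord₀.toSyn u := by
      rcases (h₁ _ _).1 hlt₁ with h | ⟨h, h'⟩
      · refine absurd ⟨_, ?_, h⟩ hA'
        change Finsupp.linearCombination ℕ _ (v.mapDomain (degreeIn hEA)) = _
        rw [← multidegree_prodExponent, ← multidegree_prodExponent, hvB]
      · exact ⟨ordA.toSyn.injective h, h'⟩
    obtain ⟨a, a', hne, hle, x, hx, hxlt⟩ := h₀ u ⟨v, Prod.ext hvB hlt₀.1, hlt₀.2⟩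
    refine ⟨_, hle, hP.pair hne, x, ?_, ?_⟩
    · exact congrArg F (congrArg Prod.fst hx)
    · exact (h₂ _ _).2 (Or.inr ⟨congrArg ordB.toSyn (congrArg Prod.fst hx),
        (h₁ _ _).2 (Or.inr ⟨congrArg ordA.toSyn (congrArg Prod.snd hx), hxlt⟩)⟩)

end Nested

/-! ### From vectors to fibers, and the theorem. -/

section Main

/-- Independence over ℤ persists over ℚ, so values on the `w i` may be prescribed and extended.
Composed with `V`, this functional is 1 on every `B i`. -/
theorem exists_dual_eq_one {d ν : ℕ} {w : Fin d → Fin ν → ℤ} (hw : LinearIndependent ℤ w) :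
    ∃ φ : (Fin ν → ℚ) →ₗ[ℚ] ℚ, ∀ i, φ (fun k => (w i k : ℚ)) = 1 := by
  have h1 : LinearIndependent ℤ fun i =>
      ((Int.castAddHom ℚ).toIntLinearMap.compLeft (Fin ν)) (w i) :=
    hw.map' _ (LinearMap.ker_eq_bot.2 fun x y h => funext fun k => by
      simpa using congrFun h k)
  have h2 := (LinearIndependent.iff_fractionRing ℤ ℚ).1 h1
  obtain ⟨φ, hφ⟩ := LinearMap.exists_extend
    ((Finsupp.linearCombination ℚ fun _ : Fin d => (1 : ℚ)) ∘ₗ h2.repr)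
  refine ⟨φ, fun i => ?_⟩
  have := LinearMap.congr_fun hφ ⟨_, Submodule.subset_span (Set.mem_range_self i)⟩
  rw [LinearMap.comp_apply, LinearMap.comp_apply, Submodule.subtype_apply,
    h2.repr_eq_single i ⟨_, Submodule.subset_span (Set.mem_range_self i)⟩ rfl,
    Finsupp.linearCombination_single, one_smul] at this
  exact this

theorem isConfiguration_iUnion {d μ ν : ℕ} (hμ : 0 < μ) (V : Matrix (Fin ν) (Fin μ) ℤ)
    {w : Fin d → Fin ν → ℤ} (hw : LinearIndependent ℤ w) (B : Fin d → Finset (Fin μ → ℤ))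
    (hB : ∀ i, ∀ b ∈ B i, V.mulVec b = w i) :
    IsConfiguration (⋃ i, (B i : Set (Fin μ → ℤ))) := by
  refine ⟨Set.finite_iUnion fun i => (B i).finite_toSet, ?_⟩
  obtain ⟨φ, hφ⟩ := exists_dual_eq_one hw
  rcases Set.eq_empty_or_nonempty (⋃ i, (B i : Set (Fin μ → ℤ))) with he | ⟨b₀, hb₀⟩
  · refine ⟨fun _ => 1, fun h => ?_, by simp [he]⟩
    simpa using congrFun h ⟨0, hμ⟩
  have key : ∀ b ∈ ⋃ i, (B i : Set (Fin μ → ℤ)),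
      ∑ j, φ (fun k => (V k j : ℚ)) * (b j : ℚ) = 1 := by
    intro b hb
    obtain ⟨i, hi⟩ := Set.mem_iUnion.1 hb
    rw [← hφ i, ← hB i b hi]
    have : (fun k => ((V.mulVec b k : ℤ) : ℚ)) = ∑ j, (b j : ℚ) • fun k => (V k j : ℚ) := by
      funext k
      simp [Matrix.mulVec, dotProduct, Finset.sum_apply, mul_comm]
    rw [this, map_sum]
    simp [mul_comm]
  refine ⟨fun j => φ (fun k => (V k j : ℚ)), fun h => ?_, key⟩
  have := key b₀ hb₀
  simp only [funext_iff, Pi.zero_apply] at h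
  simp [h] at this

/-- The vectors `b` indexed by the pairs `(i, b)` with `b ∈ B_i`. -/
def fiberVector {d μ : ℕ} (B : Fin d → Finset (Fin μ → ℤ)) (y : Σ i, B i) : Fin μ → ℤ := y.2

/-- Applying `V` turns each `b ∈ B i` into `w i`, so the multidegree can be read off by
independence. -/
theorem multidegree_eq_of_linearCombination_eq {d μ ν : ℕ} (V : Matrix (Fin ν) (Fin μ) ℤ)
    {w : Fin d → Fin ν → ℤ} (hw : LinearIndependent ℤ w) (B : Fin d → Finset (Fin μ → ℤ))
    (hB : ∀ i, ∀ b ∈ B i, V.mulVec b = w i) (p q : (Σ i, B i) →₀ ℕ)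
    (h : Finsupp.linearCombination ℕ (fiberVector B) p =
      Finsupp.linearCombination ℕ (fiberVector B) q) :
    multidegree p = multidegree q := by
  have key : ∀ p : (Σ i, B i) →₀ ℕ,
      V.mulVecLin (Finsupp.linearCombination ℕ (fiberVector B) p) =
        ∑ i, (multidegree p i : ℤ) • w i := by
    intro p
    rw [Finsupp.linearCombination_apply, Finsupp.sum_fintype _ _ (by simp), map_sum,
      Fintype.sum_sigma]
    refine Finset.sum_congr rfl fun i _ => ?_
    rw [multidegree, Nat.cast_sum, Finset.sum_smul]
    refine Finset.sum_congr rfl fun b _ => ?_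
    rw [map_nsmul, Matrix.mulVecLin_apply, fiberVector, hB i b b.2, natCast_zsmul]
  have h1 := congrArg V.mulVecLin h
  rw [key, key] at h1
  funext i
  exact_mod_cast Fintype.linearIndependent_iffₛ.1 hw _ _ h1 i

theorem linearCombination_nestedVector {d μ : ℕ} (A : Set (Fin d → ℤ))
    (B : Fin d → Finset (Fin μ → ℤ)) :
    Finsupp.linearCombination ℕ (fun a : nestedExponents A B => nestedVector B a) =
      Finsupp.linearCombination ℕ (fiberVector B) ∘ₗ prodExponent (nestedExponents A B) := by
  ext1 a
  ext1
  simp only [LinearMap.comp_apply, Finsupp.lsingle_apply, prodExponent_single,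
    Finsupp.linearCombination_single, one_smul]
  rw [Finsupp.linearCombination_apply, Finsupp.sum_fintype _ _ (by simp), Fintype.sum_sigma]
  rfl

theorem exists_initialIdeal_nested {P : ∀ ⦃ι : Type⦄, (ι →₀ ℕ) → Prop} (hP : IsTransferable P)
    {d μ ν : ℕ} {A : Set (Fin d → ℤ)} (hfin : A.Finite) (hA : ∀ a ∈ A, ∀ i, 0 ≤ a i)
    (V : Matrix (Fin ν) (Fin μ) ℤ) {w : Fin d → Fin ν → ℤ} (hw : LinearIndependent ℤ w)
    (B : Fin d → Finset (Fin μ → ℤ)) (hB : ∀ i, ∀ b ∈ B i, V.mulVec b = w i)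
    (genB : ∃ ord : MonomialOrder.{0, 0} (⋃ i, (B i : Set (Fin μ → ℤ)) : Set (Fin μ → ℤ)),
      IsGeneratedBy P ord (Finsupp.linearCombination ℕ fun b :
        (⋃ i, (B i : Set (Fin μ → ℤ)) : Set (Fin μ → ℤ)) => (b : Fin μ → ℤ)))
    (genA : ∃ ord : MonomialOrder.{0, 0} A,
      IsGeneratedBy P ord (Finsupp.linearCombination ℕ fun a : A => (a : Fin d → ℤ))) :
    (∃ ord : MonomialOrder.{0, 0} (nestedConfiguration A B),
      IsGeneratedBy P ord
        (Finsupp.linearCombination ℕ fun x : nestedConfiguration A B => (x : Fin μ → ℤ))) ∧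
    ∃ ord : MonomialOrder.{0, 0} (nestedExponents A B),
      IsGeneratedBy P ord
        (Finsupp.linearCombination ℕ fun a : nestedExponents A B => nestedVector B a) := by
  classical
  obtain ⟨ordB, genB⟩ := genB
  obtain ⟨ordA, genA⟩ := genA
  let e : (Σ i, B i) → (⋃ i, (B i : Set (Fin μ → ℤ)) : Set (Fin μ → ℤ)) :=
    fun y => ⟨y.2, Set.mem_iUnion.2 ⟨y.1, y.2.2⟩⟩
  have he : Function.Injective e := by
    rintro ⟨i, b, hb⟩ ⟨i', b', hb'⟩ h
    obtain rfl : b = b' := congrArg Subtype.val h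
    -- The `w i` are distinct, so the `B i` are disjoint and a vector determines its colour.
    obtain rfl : i = i' := hw.injective ((hB i b hb).symm.trans (hB i' b hb'))
    rfl
  have hr : ∀ x, ∃ y, e y = x := by
    rintro ⟨b, hb⟩
    obtain ⟨i, hi⟩ := Set.mem_iUnion.1 hb
    exact ⟨⟨i, b, hi⟩, rfl⟩
  choose r hr using hr
  obtain ⟨ordB', genB'⟩ := genB.restrict hP he r (fun x => by rw [hr]) (fun x => by rw [hr])
  have hEA : ∀ a, a ∈ nestedExponents A B ↔ (fun i => (multidegree a i : ℤ)) ∈ A := by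
    intro a
    simp only [multidegree, Nat.cast_sum]
    rfl
  obtain ⟨ord, gen⟩ := exists_isGeneratedBy_prodExponent hP hfin hA hEA
    (Finsupp.linearCombination ℕ (fiberVector B))
    (multidegree_eq_of_linearCombination_eq V hw B hB) genB' genA
  rw [← linearCombination_nestedVector] at gen
  refine ⟨?_, ord, gen⟩
  -- Among the variables with the same vector, keep the smallest one.
  have hrep : ∀ x : nestedConfiguration A B, ∃ a : nestedExponents A B, nestedVector B a = x ∧
      ∀ a' : nestedExponents A B, nestedVector B a' = x →
        ord.toSyn (Finsupp.single a 1) ≤ ord.toSyn (Finsupp.single a' 1) := by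
    rintro ⟨_, a, ha, rfl⟩
    obtain ⟨a₀, h₀, hmin⟩ := WellFounded.has_min
      (InvImage.wf (fun a : nestedExponents A B => ord.toSyn (Finsupp.single a 1))
        (wellFounded_lt (α := ord.syn)))
      {a' | nestedVector B a' = nestedVector B a} ⟨⟨a, ha⟩, rfl⟩
    exact ⟨a₀, h₀, fun a' h' => not_lt.1 (hmin a' h')⟩
  choose rep hvec hmin using hrep
  obtain ⟨ord', gen'⟩ := gen.restrict hP (e := rep)
    (fun x y h => Subtype.ext ((hvec x).symm.trans (h ▸ hvec y)))
    (fun a => ⟨nestedVector B a, a, a.2, rfl⟩) (fun a => hvec _) (fun a => hmin _ a rfl)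
  simp only [hvec] at gen'
  exact ⟨ord', gen'⟩

end Main

theorem mainTheorem2 (K : Type*) [Field K] (d μ ν : ℕ) (hd : 0 < d) (hμ : 0 < μ)
    (A : Set (Fin d → ℤ)) (hA : IsConfiguration A) (hA_nonneg : ∀ a ∈ A, ∀ i, 0 ≤ a i)
    (V : Matrix (Fin ν) (Fin μ) ℤ) (w : Fin d → Fin ν → ℤ) (hw : LinearIndependent ℤ w)
    (B : Fin d → Finset (Fin μ → ℤ)) (hB : ∀ i, ∀ b ∈ B i, V.mulVec b = w i) :
    IsConfiguration (⋃ i, (B i : Set (Fin μ → ℤ))) ∧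
    (∀ m : ℕ, 2 ≤ m →
      AdmitsInitialIdealOfDegreeLE m (toricIdealOfSet K (⋃ i, (B i : Set (Fin μ → ℤ)))) →
      AdmitsInitialIdealOfDegreeLE m (toricIdealOfSet K A) →
      AdmitsInitialIdealOfDegreeLE m (toricIdealOfSet K (nestedConfiguration A B)) ∧
      AdmitsInitialIdealOfDegreeLE m (nestedMatrixToricIdeal K A B)) ∧
    (AdmitsSquarefreeInitialIdeal (toricIdealOfSet K (⋃ i, (B i : Set (Fin μ → ℤ)))) →
      AdmitsSquarefreeInitialIdeal (toricIdealOfSet K A) →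
      AdmitsSquarefreeInitialIdeal (toricIdealOfSet K (nestedConfiguration A B)) ∧
      AdmitsSquarefreeInitialIdeal (nestedMatrixToricIdeal K A B)) := by
  have admits_iff : ∀ (P : ∀ ⦃ι : Type⦄, (ι →₀ ℕ) → Prop) {ι κ : Type} (a : ι → κ → ℤ), _ :=
    fun P _ _ a => exists_initialIdeal_toricIdeal_iff K a P
  refine ⟨isConfiguration_iUnion hμ V hw B hB, fun m hm genB genA => ?_, fun genB genA => ?_⟩
  · have h := exists_initialIdeal_nested (isTransferable_degree_le hm) hA.1 hA_nonneg V hw B hB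
      ((admits_iff _ _).1 genB) ((admits_iff _ _).1 genA)
    exact ⟨(admits_iff _ _).2 h.1, (admits_iff _ _).2 h.2⟩
  · have h := exists_initialIdeal_nested isTransferable_squarefree hA.1 hA_nonneg V hw B hB
      ((admits_iff _ _).1 genB) ((admits_iff _ _).1 genA)
    exact ⟨(admits_iff _ _).2 h.1, (admits_iff _ _).2 h.2⟩
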